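/- Let $(M,\langle\cdot,\cdot\rangle)$ be a smooth Riemannian $3$-manifold (Hausdorff, without boundary) of constant sectional curvature $c\in\mathbb{R}$, with Levi-Civita connection $\nabla$. Let $X$ be a complete geodesic vector field on $M$, i.e. a smooth vector field with $|X|\equiv 1$ and $\nabla_X X=0$, all of whose integral curves are defined on all of $\mathbb{R}$. For $p\in M$ let $X_p^\perp\subset T_pM$ be the orthogonal complement of $X_p$, and let $$\beta_p\colon X_p^\perp\longrightarrow X_p^\perp,\qquad v\longmapsto \nabla_v X,$$ which is well defined because $|X|\equiv 1$. Then for every $p\in M$: - if $c>0$, then $\beta_p$ has no real eigenvalues; - if $c=0$ and $\lambda$ is a real eigenvalue of $\beta_p$, then $\lambda=0$; - if $c<0$ and $\lambda$ is a real eigenvalue of $\beta_p$, then $|\lambda|\le\sqrt{|c|}$. -/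

import Mathlib

open Bundle VectorField
open scoped Manifold ContDiff

set_option linter.unusedSectionVars false

namespace RiemannianGeometry

section LeviCivita

variable {E : Type*} [NormedAddCommGroup E] [NormedSpace ℝ E] [FiniteDimensional ℝ E]
  {H : Type*} [TopologicalSpace H] {I : ModelWithCorners ℝ E H}
  {M : Type*} [TopologicalSpace M] [ChartedSpace H M] [IsManifold I ∞ M]
  [RiemannianBundle (fun x : M => TangentSpace I x)]

/-- The right-hand side of the Koszul formula for `2 ⟨∇_X Y, Z⟩` at the point `x`. -/
noncomputable def koszul (X Y Z : Π x : M, TangentSpace I x) (x : M) : ℝ :=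
  d% (fun y => inner ℝ (Y y) (Z y)) x (X x)
    + d% (fun y => inner ℝ (Z y) (X y)) x (Y x)
    - d% (fun y => inner ℝ (X y) (Y y)) x (Z x)
    + inner ℝ (mlieBracket I X Y x) (Z x)
    - inner ℝ (mlieBracket I X Z x) (Y x)
    - inner ℝ (mlieBracket I Y Z x) (X x)

variable [IsContMDiffRiemannianBundle I ∞ E (fun x : M => TangentSpace I x)]

theorem mdifferentiableAt_inner {x : M} {X Y : Π x : M, TangentSpace I x}
    (hX : MDiffAt (T% X) x) (hY : MDiffAt (T% Y) x) :
    MDiffAt (fun y => inner ℝ (X y) (Y y)) x :=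
  MDifferentiableAt.inner_bundle (F := E) (E := fun x : M => TangentSpace I x) hX hY

theorem koszul_tensorial_left {x : M} {Y Z : Π x : M, TangentSpace I x}
    (hY : MDiffAt (T% Y) x) (hZ : MDiffAt (T% Z) x) :
    TensorialAt I E (fun X : Π x : M, TangentSpace I x => koszul X Y Z x) x where
  smul {f X} hf hX := by
    have : CompleteSpace E := FiniteDimensional.complete ℝ E
    have h1 : (fun y => inner ℝ (Z y) ((f • X) y)) = fun y => f y * inner ℝ (Z y) (X y) := by
      ext y; simp [inner_smul_right]
    have h2 : (fun y => inner ℝ ((f • X) y) (Y y)) = fun y => f y * inner ℝ (X y) (Y y) := by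
      ext y; simp [inner_smul_left]
    simp only [koszul, h1, h2]
    rw [mvfderiv_fun_mul hf (mdifferentiableAt_inner hZ hX), mvfderiv_fun_mul hf (mdifferentiableAt_inner hX hY),
      mlieBracket_smul_left hf hX, mlieBracket_smul_left hf hX]
    simp [inner_add_left, inner_smul_left, inner_smul_right, real_inner_comm]
    ring
  add {X X'} hX hX' := by
    have : CompleteSpace E := FiniteDimensional.complete ℝ E
    have h1 : (fun y => inner ℝ (Z y) ((X + X') y)) =
        fun y => inner ℝ (Z y) (X y) + inner ℝ (Z y) (X' y) := by
      ext y; simp [inner_add_right]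
    have h2 : (fun y => inner ℝ ((X + X') y) (Y y)) =
        fun y => inner ℝ (X y) (Y y) + inner ℝ (X' y) (Y y) := by
      ext y; simp [inner_add_left]
    simp only [koszul, h1, h2]
    rw [mvfderiv_fun_add (mdifferentiableAt_inner hZ hX) (mdifferentiableAt_inner hZ hX'),
      mvfderiv_fun_add (mdifferentiableAt_inner hX hY) (mdifferentiableAt_inner hX' hY),
      mlieBracket_add_left hX hX', mlieBracket_add_left hX hX']
    simp [inner_add_left, inner_add_right]
    ring

theorem koszul_tensorial_right {x : M} {X Y : Π x : M, TangentSpace I x}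
    (hX : MDiffAt (T% X) x) (hY : MDiffAt (T% Y) x) :
    TensorialAt I E (fun Z : Π x : M, TangentSpace I x => koszul X Y Z x) x where
  smul {f Z} hf hZ := by
    have : CompleteSpace E := FiniteDimensional.complete ℝ E
    have h1 : (fun y => inner ℝ (Y y) ((f • Z) y)) = fun y => f y * inner ℝ (Y y) (Z y) := by
      ext y; simp [inner_smul_right]
    have h2 : (fun y => inner ℝ ((f • Z) y) (X y)) = fun y => f y * inner ℝ (Z y) (X y) := by
      ext y; simp [inner_smul_left]
    simp only [koszul, h1, h2]
    rw [mvfderiv_fun_mul hf (mdifferentiableAt_inner hY hZ), mvfderiv_fun_mul hf (mdifferentiableAt_inner hZ hX),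
      mlieBracket_smul_right hf hZ, mlieBracket_smul_right hf hZ]
    simp [inner_add_left, inner_smul_left, inner_smul_right, real_inner_comm]
    ring
  add {Z Z'} hZ hZ' := by
    have : CompleteSpace E := FiniteDimensional.complete ℝ E
    have h1 : (fun y => inner ℝ (Y y) ((Z + Z') y)) =
        fun y => inner ℝ (Y y) (Z y) + inner ℝ (Y y) (Z' y) := by
      ext y; simp [inner_add_right]
    have h2 : (fun y => inner ℝ ((Z + Z') y) (X y)) =
        fun y => inner ℝ (Z y) (X y) + inner ℝ (Z' y) (X y) := by
      ext y; simp [inner_add_left]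
    simp only [koszul, h1, h2]
    rw [mvfderiv_fun_add (mdifferentiableAt_inner hY hZ) (mdifferentiableAt_inner hY hZ'),
      mvfderiv_fun_add (mdifferentiableAt_inner hZ hX) (mdifferentiableAt_inner hZ' hX),
      mlieBracket_add_right hZ hZ', mlieBracket_add_right hZ hZ']
    simp [inner_add_left, inner_add_right]
    ring

/-- For a vector field `Y` differentiable at `x`, the bilinear form
`(v, w) ↦ 2 ⟨∇_v Y, w⟩` on `T_xM` given by the Koszul formula. -/
noncomputable def koszulForm (Y : Π x : M, TangentSpace I x) (x : M) (hY : MDiffAt (T% Y) x) :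
    TangentSpace I x →L[ℝ] TangentSpace I x →L[ℝ] ℝ :=
  TensorialAt.mkHom₂ (I := I) (F := E) (F' := E) (fun X Z => koszul X Y Z x) x
    (fun _ hZ => koszul_tensorial_left hY hZ) (fun _ hX => koszul_tensorial_right hX hY)

theorem koszulForm_apply {x : M} {X Y Z : Π x : M, TangentSpace I x}
    (hX : MDiffAt (T% X) x) (hY : MDiffAt (T% Y) x) (hZ : MDiffAt (T% Z) x) :
    koszulForm Y x hY (X x) (Z x) = koszul X Y Z x :=
  TensorialAt.mkHom₂_apply (I := I) (F := E) (F' := E) (Φ := fun X Z => koszul X Y Z x)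
    (fun _ hZ => koszul_tensorial_left hY hZ) (fun _ hX => koszul_tensorial_right hX hY) hX hZ

theorem exists_riesz {x : M} (B : TangentSpace I x →L[ℝ] TangentSpace I x →L[ℝ] ℝ) :
    ∃ A : TangentSpace I x →L[ℝ] TangentSpace I x, ∀ v w, inner ℝ (A v) w = B v w := by
  have : FiniteDimensional ℝ (TangentSpace I x) := inferInstanceAs (FiniteDimensional ℝ E)
  have : CompleteSpace (TangentSpace I x) := FiniteDimensional.complete ℝ _
  let R := (InnerProductSpace.toDual ℝ (TangentSpace I x)).symm
  let A : TangentSpace I x →ₗ[ℝ] TangentSpace I x :=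
    { toFun := fun v => R (B v)
      map_add' := fun v w => by simp
      map_smul' := fun a v => by simp }
  refine ⟨LinearMap.toContinuousLinearMap A, fun v w => ?_⟩
  exact InnerProductSpace.toDual_symm_apply

open Classical in
/-- The underlying map of the Levi-Civita connection: `leviCivitaFun Y x v` is `∇_v Y`, the vector
with `⟨∇_v Y, w⟩ = (1/2) koszulForm Y x v w` for all `w` (and zero if `Y` is not differentiable
at `x`). -/
noncomputable def leviCivitaFun (Y : Π x : M, TangentSpace I x) (x : M) :
    TangentSpace I x →L[ℝ] TangentSpace I x :=
  if hY : MDiffAt (T% Y) x then (exists_riesz ((1 / 2 : ℝ) • koszulForm Y x hY)).choose else 0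

theorem two_mul_inner_leviCivitaFun {x : M} {X Y Z : Π x : M, TangentSpace I x}
    (hX : MDiffAt (T% X) x) (hY : MDiffAt (T% Y) x) (hZ : MDiffAt (T% Z) x) :
    2 * inner ℝ (leviCivitaFun Y x (X x)) (Z x) = koszul X Y Z x := by
  rw [leviCivitaFun, dif_pos hY, (exists_riesz ((1 / 2 : ℝ) • koszulForm Y x hY)).choose_spec,
    ← koszulForm_apply hX hY hZ]
  simp

theorem clm_ext_inner_fields {x : M} {A B : TangentSpace I x →L[ℝ] TangentSpace I x}
    (h : ∀ X Z : Π x : M, TangentSpace I x, MDiffAt (T% X) x → MDiffAt (T% Z) x →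
      2 * inner ℝ (A (X x)) (Z x) = 2 * inner ℝ (B (X x)) (Z x)) : A = B := by
  ext v
  refine ext_inner_right ℝ fun w => ?_
  have := h (FiberBundle.extend E v) (FiberBundle.extend E w)
    (FiberBundle.mdifferentiableAt_extend ..) (FiberBundle.mdifferentiableAt_extend ..)
  simp only [FiberBundle.extend_apply_self] at this
  linarith

variable (I M) in
/-- The Levi-Civita connection of a Riemannian manifold; `leviCivita I M Y x v` is `∇_v Y`. -/
noncomputable def leviCivita : CovariantDerivative I E (fun x : M => TangentSpace I x) where
  toFun := leviCivitaFun
  isCovariantDerivativeOnUniv :=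
    { add := by
        intro Y Y' x hY hY' _
        have : CompleteSpace E := FiniteDimensional.complete ℝ E
        refine clm_ext_inner_fields fun X Z hX hZ => ?_
        have hs := mdifferentiableAt_add_section hY hY'
        rw [two_mul_inner_leviCivitaFun hX hs hZ, add_apply, inner_add_left,
          mul_add, two_mul_inner_leviCivitaFun hX hY hZ, two_mul_inner_leviCivitaFun hX hY' hZ]
        have h1 : (fun y => inner ℝ ((Y + Y') y) (Z y)) =
            fun y => inner ℝ (Y y) (Z y) + inner ℝ (Y' y) (Z y) := by
          ext y; simp [inner_add_left]
        have h2 : (fun y => inner ℝ (X y) ((Y + Y') y)) =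
            fun y => inner ℝ (X y) (Y y) + inner ℝ (X y) (Y' y) := by
          ext y; simp [inner_add_right]
        simp only [koszul, h1, h2]
        rw [mvfderiv_fun_add (mdifferentiableAt_inner hY hZ) (mdifferentiableAt_inner hY' hZ),
          mvfderiv_fun_add (mdifferentiableAt_inner hX hY) (mdifferentiableAt_inner hX hY'),
          mlieBracket_add_left hY hY', mlieBracket_add_right hY hY']
        simp [inner_add_left, inner_add_right]
        ring
      leibniz := by
        intro Y f x hY hf _
        have : CompleteSpace E := FiniteDimensional.complete ℝ E
        refine clm_ext_inner_fields fun X Z hX hZ => ?_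
        have hs := hf.smul_section hY
        rw [two_mul_inner_leviCivitaFun hX hs hZ]
        have h0 := two_mul_inner_leviCivitaFun hX hY hZ
        have h1 : (fun y => inner ℝ ((f • Y) y) (Z y)) = fun y => f y * inner ℝ (Y y) (Z y) := by
          ext y; simp [inner_smul_left]
        have h2 : (fun y => inner ℝ (X y) ((f • Y) y)) = fun y => f y * inner ℝ (X y) (Y y) := by
          ext y; simp [inner_smul_right]
        have h3 : 2 * inner ℝ ((f x • leviCivitaFun Y x + (d% f x).smulRight (Y x)) (X x)) (Z x)
            = f x * koszul X Y Z x + 2 * (d% f x (X x) * inner ℝ (Y x) (Z x)) := by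
          rw [← h0]
          simp [inner_add_left, inner_smul_left]
          ring
        rw [h3]
        simp only [koszul, h1, h2]
        rw [mvfderiv_fun_mul hf (mdifferentiableAt_inner hY hZ),
          mvfderiv_fun_mul hf (mdifferentiableAt_inner hX hY),
          mlieBracket_smul_left hf hY, mlieBracket_smul_right hf hY]
        simp [inner_add_left, inner_smul_left, inner_smul_right, real_inner_comm]
        ring }

theorem two_mul_inner_leviCivita {x : M} {X Y Z : Π x : M, TangentSpace I x}
    (hX : MDiffAt (T% X) x) (hY : MDiffAt (T% Y) x) (hZ : MDiffAt (T% Z) x) :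
    2 * inner ℝ (leviCivita I M Y x (X x)) (Z x) = koszul X Y Z x :=
  two_mul_inner_leviCivitaFun hX hY hZ

/-- The Levi-Civita connection is compatible with the metric. -/
theorem leviCivita_metric {x : M} {X Y Z : Π x : M, TangentSpace I x}
    (hX : MDiffAt (T% X) x) (hY : MDiffAt (T% Y) x) (hZ : MDiffAt (T% Z) x) :
    d% (fun y => inner ℝ (Y y) (Z y)) x (X x) =
      inner ℝ (leviCivita I M Y x (X x)) (Z x) + inner ℝ (Y x) (leviCivita I M Z x (X x)) := by
  have h1 := two_mul_inner_leviCivita hX hY hZ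
  have h2 := two_mul_inner_leviCivita hX hZ hY
  have e1 : (fun y => inner ℝ (Z y) (Y y)) = fun y => inner ℝ (Y y) (Z y) := by
    ext y; exact real_inner_comm _ _
  have e2 : (fun y => inner ℝ (Y y) (X y)) = fun y => inner ℝ (X y) (Y y) := by
    ext y; exact real_inner_comm _ _
  have e3 : (fun y => inner ℝ (X y) (Z y)) = fun y => inner ℝ (Z y) (X y) := by
    ext y; exact real_inner_comm _ _
  have e4 : mlieBracket I Z Y x = - mlieBracket I Y Z x := mlieBracket_swap_apply
  simp only [koszul, e1, e2, e3, e4, inner_neg_left] at h1 h2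
  rw [real_inner_comm (leviCivita I M Z x (X x)) (Y x)]
  linarith

/-- The Levi-Civita connection is torsion-free. -/
theorem leviCivita_torsionFree {x : M} {X Y : Π x : M, TangentSpace I x}
    (hX : MDiffAt (T% X) x) (hY : MDiffAt (T% Y) x) :
    leviCivita I M Y x (X x) - leviCivita I M X x (Y x) = mlieBracket I X Y x := by
  refine ext_inner_right ℝ fun w => ?_
  have hZ := FiberBundle.mdifferentiableAt_extend I E w
  have h1 := two_mul_inner_leviCivita hX hY hZ
  have h2 := two_mul_inner_leviCivita hY hX hZ
  set Z := FiberBundle.extend E w with hZdef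
  have hw : Z x = w := FiberBundle.extend_apply_self E w
  have e1 : (fun y => inner ℝ (Z y) (Y y)) = fun y => inner ℝ (Y y) (Z y) := by
    ext y; exact real_inner_comm _ _
  have e2 : (fun y => inner ℝ (Y y) (X y)) = fun y => inner ℝ (X y) (Y y) := by
    ext y; exact real_inner_comm _ _
  have e3 : (fun y => inner ℝ (X y) (Z y)) = fun y => inner ℝ (Z y) (X y) := by
    ext y; exact real_inner_comm _ _
  have e4 : mlieBracket I Y X x = - mlieBracket I X Y x := mlieBracket_swap_apply
  simp only [koszul, e1, e2, e3, e4, inner_neg_left] at h1 h2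
  rw [← hw, inner_sub_left]
  linarith

/-- The curvature `R(X, Y) Z = ∇_X ∇_Y Z - ∇_Y ∇_X Z - ∇_{[X, Y]} Z` of the Levi-Civita connection,
applied to smooth vector fields. -/
noncomputable def curvature (X Y Z : Π x : M, TangentSpace I x) (x : M) : TangentSpace I x :=
  leviCivita I M (fun y => leviCivita I M Z y (Y y)) x (X x)
    - leviCivita I M (fun y => leviCivita I M Z y (X y)) x (Y x)
    - leviCivita I M Z x (mlieBracket I X Y x)

/-- The sectional curvature at `x` of the plane spanned by `X x` and `Y x`, for smooth vector fields
`X`, `Y` that are linearly independent at `x`. -/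
noncomputable def sectionalCurvature (X Y : Π x : M, TangentSpace I x) (x : M) : ℝ :=
  inner ℝ (curvature X Y Y x) (X x) /
    (inner ℝ (X x) (X x) * inner ℝ (Y x) (Y x) - inner ℝ (X x) (Y x) ^ 2)

variable (I M) in
/-- All sectional curvatures of all tangent planes of `M` are equal to `c`. Every tangent plane
of a (Hausdorff) manifold is spanned by the values of two globally defined smooth vector fields. -/
def HasConstantSectionalCurvature (c : ℝ) : Prop :=
  ∀ (x : M) (X Y : Π x : M, TangentSpace I x), CMDiff ∞ (T% X) → CMDiff ∞ (T% Y) →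
    LinearIndependent ℝ ![X x, Y x] → sectionalCurvature X Y x = c

/-- A geodesic vector field: a smooth unit vector field `X` with `∇_X X = 0`. -/
structure IsGeodesicField (X : Π x : M, TangentSpace I x) : Prop where
  smooth : CMDiff ∞ (T% X)
  norm_eq_one : ∀ x, ‖X x‖ = 1
  leviCivita_self : ∀ x, leviCivita I M X x (X x) = 0

/-- A vector field is complete if through every point there passes an integral curve that is
defined for all times. -/
def IsCompleteField (X : Π x : M, TangentSpace I x) : Prop :=
  ∀ x : M, ∃ γ : ℝ → M, γ 0 = x ∧ IsMIntegralCurve γ X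

theorem IsGeodesicField.inner_leviCivita {X : Π x : M, TangentSpace I x} (hX : IsGeodesicField X)
    (x : M) (v : TangentSpace I x) : inner ℝ (X x) (leviCivita I M X x v) = 0 := by
  have hXx : MDiffAt (T% X) x := hX.smooth.mdifferentiable (by simp) x
  have h := leviCivita_metric (FiberBundle.mdifferentiableAt_extend I E v) hXx hXx
  have h1 : (fun y => inner ℝ (X y) (X y)) = fun _ : M => (1 : ℝ) := by
    ext y
    rw [real_inner_self_eq_norm_sq, hX.norm_eq_one y, one_pow]
  rw [h1, mvfderiv_const, FiberBundle.extend_apply_self E v, real_inner_comm] at h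
  simp only [zero_apply] at h
  linarith

/-- The endomorphism `β_x : X_x^⊥ → X_x^⊥`, `v ↦ ∇_v X`, of the orthogonal complement of a geodesic
vector field `X` at the point `x`. -/
noncomputable def beta (X : Π x : M, TangentSpace I x) (hX : IsGeodesicField X) (x : M) :
    Module.End ℝ (Submodule.span ℝ {X x})ᗮ :=
  (leviCivita I M X x).toLinearMap.restrict (fun v _ =>
    Submodule.mem_orthogonal_singleton_iff_inner_right.2 (hX.inner_leviCivita x v))

end LeviCivita

end RiemannianGeometry

/-! Along an integral curve of `X`, constant curvature turns the Jacobi equation into the Riccati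
equation `β' = -β² - c`. If `β v = μ v` at time `0`, the field that the flow of `X` carries along
from `v` should be `s` times the parallel translate of `v`, where `s'' = -c s`, `s 0 = 1`, `s' 0 =
μ`. The flow is invertible, so `s` cannot vanish. But `s` is `cos kt + (μ/k) sin kt`, `1 + μ t` or
`cosh kt + (μ/k) sinh kt`, with `k = √|c|`, according to the sign of `c`; it has a real zero when `c
> 0`, when `c = 0` and `μ ≠ 0`, and when `c < 0` and `|μ| > k`.

The proof avoids parallel transport and the flow by working with the trace `T` and determinant `D`
of `β`. These satisfy a closed system of equations (`IsGeodesicField.hasDerivAt_shape`), obtained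
from the Riccati equation in a local orthonormal frame (`IsGeodesicField.riccati`). The function `q
= det(s' - s β) = s'² - T s s' + D s²` then satisfies `q' = -T q` and vanishes at `0`, hence
everywhere, so `s' = 0` wherever `s = 0` (`deriv_eq_zero_of_riccati`). A nonzero solution of `s'' =
-c s` has no such double zero, and `riccati_eigenvalue` concludes.

The curvature term of the Riccati equation is `c` times the identity by polarisation, which rests on
the pair symmetry `inner_curvature_pair_symm`. -/

namespace RiemannianGeometry

open Filter Topology

/-! ### Lie brackets, derivatives of functions, and globally smooth extensions -/

section LieDerivative

variable {E : Type*} [NormedAddCommGroup E] [NormedSpace ℝ E] [FiniteDimensional ℝ E]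
  {H : Type*} [TopologicalSpace H] {I : ModelWithCorners ℝ E H}
  {M : Type*} [TopologicalSpace M] [ChartedSpace H M] [IsManifold I ∞ M]

theorem contMDiff_mvfderiv_apply {f : M → ℝ} {V : Π x : M, TangentSpace I x}
    (hf : CMDiff ∞ f) (hV : CMDiff ∞ (T% V)) : CMDiff ∞ (fun y => d% f y (V y)) := by
  have h1 := hf.contMDiff_tangentMap (m := ∞) (by simp)
  have h2 := (contMDiff_snd_tangentBundle_modelSpace ℝ 𝓘(ℝ, ℝ) (n := ∞)).comp (h1.comp hV)
  exact h2

theorem ContMDiff.mdiffAt_section {V : Π x : M, TangentSpace I x}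
    (hV : CMDiff ∞ (T% V)) (x : M) : MDiffAt (T% V) x :=
  hV.mdifferentiable (by simp) x

theorem contMDiff_mlieBracket {U V : Π x : M, TangentSpace I x}
    (hU : CMDiff ∞ (T% U)) (hV : CMDiff ∞ (T% V)) : CMDiff ∞ (T% (mlieBracket I U V)) := by
  have : CompleteSpace E := FiniteDimensional.complete ℝ E
  have : IsManifold I ((((⊤ : ℕ∞) : ℕ∞ω)) + 1) M := by simpa using ‹IsManifold I ∞ M›
  have : IsManifold I (minSmoothness ℝ 2) M := by
    simp only [minSmoothness_of_isRCLikeNormedField]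
    exact IsManifold.of_le (n := ∞) ENat.LEInfty.out
  exact _root_.ContDiff.mlieBracket_vectorField (n := ⊤) (m := ⊤) hU hV (by simp)

theorem mlieBracket_jacobi {U V W : Π x : M, TangentSpace I x}
    (hU : CMDiff ∞ (T% U)) (hV : CMDiff ∞ (T% V)) (hW : CMDiff ∞ (T% W)) (x : M) :
    mlieBracket I U (mlieBracket I V W) x =
      mlieBracket I (mlieBracket I U V) W x + mlieBracket I V (mlieBracket I U W) x := by
  have : CompleteSpace E := FiniteDimensional.complete ℝ E
  have : IsManifold I (minSmoothness ℝ 3) M := by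
    simp only [minSmoothness_of_isRCLikeNormedField]
    exact IsManifold.of_le (n := ∞) ENat.LEInfty.out
  have h2 : minSmoothness ℝ 2 ≤ ∞ := by
    simp only [minSmoothness_of_isRCLikeNormedField]
    exact ENat.LEInfty.out
  exact leibniz_identity_mlieBracket_apply (hU.of_le h2 x) (hV.of_le h2 x) (hW.of_le h2 x)

/-- The Lie bracket acts on functions as a commutator (on a manifold carrying a vector field that
does not vanish at `x`). -/
theorem mvfderiv_mlieBracket {f : M → ℝ} {U V W : Π x : M, TangentSpace I x}
    (hf : CMDiff ∞ f) (hU : CMDiff ∞ (T% U)) (hV : CMDiff ∞ (T% V)) (hW : CMDiff ∞ (T% W))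
    {x : M} (hWx : W x ≠ 0) :
    d% f x (mlieBracket I U V x) =
      d% (fun y => d% f y (V y)) x (U x) - d% (fun y => d% f y (U y)) x (V x) := by
  have : CompleteSpace E := FiniteDimensional.complete ℝ E
  -- The Jacobi identity for `U`, `V`, `f • W`, expanded by the Leibniz rule, yields the claim as
  -- the coefficient of `W`; all other terms cancel by the Jacobi identity for `U`, `V`, `W`.
  have key : ∀ {P Q : Π x : M, TangentSpace I x}, CMDiff ∞ (T% P) → CMDiff ∞ (T% Q) →
      mlieBracket I P (mlieBracket I Q (f • W)) x =
        d% (fun y => d% f y (Q y)) x (P x) • W x + d% f x (Q x) • mlieBracket I P W x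
          + (d% f x (P x) • mlieBracket I Q W x
            + f x • mlieBracket I P (mlieBracket I Q W) x) := by
    intro P Q hP hQ
    have hfun : mlieBracket I Q (f • W) =
        (fun y => d% f y (Q y)) • W + f • mlieBracket I Q W := by
      funext y
      exact mlieBracket_smul_right (hf.mdifferentiable (by simp) y)
        (ContMDiff.mdiffAt_section hW y)
    have hd := contMDiff_mvfderiv_apply hf hQ
    have hQW := contMDiff_mlieBracket hQ hW
    rw [hfun, mlieBracket_add_right
      (ContMDiff.mdiffAt_section (hd.smul_section hW) x)
      (ContMDiff.mdiffAt_section (hf.smul_section hQW) x),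
      mlieBracket_smul_right (hd.mdifferentiable (by simp) x) (ContMDiff.mdiffAt_section hW x),
      mlieBracket_smul_right (hf.mdifferentiable (by simp) x) (ContMDiff.mdiffAt_section hQW x)]
  have hj := mlieBracket_jacobi hU hV (hf.smul_section hW) x
  have hj0 := mlieBracket_jacobi hU hV hW x
  rw [key hU hV, key hV hU, mlieBracket_smul_right (hf.mdifferentiable (by simp) x)
    (ContMDiff.mdiffAt_section hW x), hj0] at hj
  have h : (d% f x (mlieBracket I U V x) -
      (d% (fun y => d% f y (V y)) x (U x) - d% (fun y => d% f y (U y)) x (V x))) • W x = 0 := by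
    rw [← sub_eq_zero] at hj
    rw [← neg_eq_zero, ← hj]
    module
  exact sub_eq_zero.1 ((smul_eq_zero.1 h).resolve_right hWx)

variable [T2Space M]

/-- A vector field that is smooth near `x` agrees near `x` with a globally smooth one. -/
theorem exists_contMDiff_eventuallyEq {x : M} {V : Π x : M, TangentSpace I x}
    (hV : ∀ᶠ y in 𝓝 x, CMDiffAt ∞ (T% V) y) :
    ∃ W : Π x : M, TangentSpace I x, CMDiff ∞ (T% W) ∧ ∀ᶠ y in 𝓝 x, W y = V y := by
  obtain ⟨u, hu, huo, hxu⟩ := eventually_nhds_iff.1 hV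
  obtain ⟨f, -, hf⟩ := (SmoothBumpFunction.nhds_basis_tsupport (I := I) x).mem_iff.1
    (huo.mem_nhds hxu)
  refine ⟨(f : M → ℝ) • V, ?_, ?_⟩
  · exact ContMDiffOn.smul_section_of_tsupport (n := ∞) f.contMDiff.contMDiffOn huo hf
      (fun y hy => (hu y hy).contMDiffWithinAt)
  · filter_upwards [f.eventuallyEq_one] with y hy
    simp [hy]

theorem exists_contMDiff_apply_eq (x : M) (v : TangentSpace I x) :
    ∃ W : Π x : M, TangentSpace I x, CMDiff ∞ (T% W) ∧ W x = v := by
  obtain ⟨W, hW, h⟩ := exists_contMDiff_eventuallyEq (I := I) (x := x)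
    (V := FiberBundle.extend E v) (by
      obtain ⟨s, hs, h⟩ := FiberBundle.exists_contMDiffOn_extend (k := ∞) I E v
      filter_upwards [eventually_mem_nhds_iff.2 hs] with y hy
      exact h.contMDiffAt hy)
  exact ⟨W, hW, h.self_of_nhds.trans (FiberBundle.extend_apply_self E v)⟩

end LieDerivative

/-! ### Orthonormal triples in a three-dimensional space -/

section OrthonormalBasis

variable {E : Type*} [NormedAddCommGroup E] [InnerProductSpace ℝ E]

theorem exists_orthonormalBasis_coe_eq [FiniteDimensional ℝ E] {ι : Type*} [Fintype ι] {e : ι → E}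
    (h : Orthonormal ℝ e) (hcard : Fintype.card ι = Module.finrank ℝ E) :
    ∃ O : OrthonormalBasis ι ℝ E, ⇑O = e :=
  ⟨OrthonormalBasis.mk h (h.linearIndependent.span_eq_top_of_card_eq_finrank' hcard).ge,
    OrthonormalBasis.coe_mk _ _⟩

theorem orthonormal_triple_expansion (hdim : Module.finrank ℝ E = 3) {a b c : E}
    (h : Orthonormal ℝ ![a, b, c]) (v : E) :
    v = inner ℝ a v • a + inner ℝ b v • b + inner ℝ c v • c := by
  have : FiniteDimensional ℝ E := Module.finite_of_finrank_pos (by omega)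
  obtain ⟨O, hO⟩ := exists_orthonormalBasis_coe_eq h (by simp [hdim])
  simpa [hO, Fin.sum_univ_three] using (O.sum_repr' v).symm

theorem trace_eq_of_orthonormal_triple (hdim : Module.finrank ℝ E = 3) {a b c : E}
    (h : Orthonormal ℝ ![a, b, c]) (T : E →ₗ[ℝ] E) :
    LinearMap.trace ℝ E T = inner ℝ a (T a) + inner ℝ b (T b) + inner ℝ c (T c) := by
  have : FiniteDimensional ℝ E := Module.finite_of_finrank_pos (by omega)
  obtain ⟨O, hO⟩ := exists_orthonormalBasis_coe_eq h (by simp [hdim])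
  simp [LinearMap.trace_eq_sum_inner T O, hO, Fin.sum_univ_three]

end OrthonormalBasis

/-! ### Local orthonormal frames -/

section OrthonormalFrame

variable {E : Type*} [NormedAddCommGroup E] [NormedSpace ℝ E] [FiniteDimensional ℝ E]
  {H : Type*} [TopologicalSpace H] {I : ModelWithCorners ℝ E H}
  {M : Type*} [TopologicalSpace M] [ChartedSpace H M] [IsManifold I ∞ M]
  [RiemannianBundle (fun x : M => TangentSpace I x)]
  [IsContMDiffRiemannianBundle I ∞ E (fun x : M => TangentSpace I x)]

theorem contMDiff_inner {V W : Π x : M, TangentSpace I x}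
    (hV : CMDiff ∞ (T% V)) (hW : CMDiff ∞ (T% W)) :
    CMDiff ∞ (fun y => inner ℝ (V y) (W y)) :=
  ContMDiff.inner_bundle (F := E) (E := fun x : M => TangentSpace I x) hV hW

theorem exists_ne_zero_forall_inner_eq_zero {ι : Type*} [Fintype ι] {x : M}
    (e : ι → TangentSpace I x) (h : Fintype.card ι < Module.finrank ℝ E) :
    ∃ w : TangentSpace I x, w ≠ 0 ∧ ∀ i, inner ℝ (e i) w = 0 := by
  have : FiniteDimensional ℝ (TangentSpace I x) := inferInstanceAs (FiniteDimensional ℝ E)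
  have h1 : Module.finrank ℝ (Submodule.span ℝ (Set.range e)) ≤ Fintype.card ι :=
    finrank_range_le_card e
  have h2 := (Submodule.span ℝ (Set.range e)).finrank_add_finrank_orthogonal
  have h3 : Module.finrank ℝ (TangentSpace I x) = Module.finrank ℝ E := rfl
  have h4 : (Submodule.span ℝ (Set.range e))ᗮ ≠ ⊥ := by
    intro h0
    rw [h0, finrank_bot] at h2
    omega
  obtain ⟨w, hw, hw0⟩ := Submodule.exists_mem_ne_zero_of_ne_bot h4
  exact ⟨w, hw0, fun i => Submodule.inner_right_of_mem_orthogonal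
    (Submodule.subset_span (Set.mem_range_self i)) hw⟩

variable [T2Space M]

/-- The Gram–Schmidt step for vector fields: a locally orthonormal family of fewer than `dim M`
vector fields can be extended by one more vector field. -/
theorem exists_unit_field_orthogonal {ι : Type*} [Fintype ι] {x : M}
    {e : ι → Π x : M, TangentSpace I x} (he : ∀ i, CMDiff ∞ (T% (e i)))
    (hon : ∀ᶠ y in 𝓝 x, Orthonormal ℝ (fun i => e i y))
    (h : Fintype.card ι < Module.finrank ℝ E) :
    ∃ W : Π x : M, TangentSpace I x, CMDiff ∞ (T% W) ∧
      ∀ᶠ y in 𝓝 x, ‖W y‖ = 1 ∧ ∀ i, inner ℝ (e i y) (W y) = 0 := by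
  classical
  obtain ⟨w, hw0, hw⟩ := exists_ne_zero_forall_inner_eq_zero (fun i => e i x) h
  obtain ⟨W, hW, hWx⟩ := exists_contMDiff_apply_eq x w
  -- The Gram–Schmidt remainder: it equals `w ≠ 0` at `x`, hence is nonzero nearby.
  let P : Π x : M, TangentSpace I x := fun y => W y - ∑ i, inner ℝ (e i y) (W y) • e i y
  have hP : CMDiff ∞ (T% P) := hW.sub_section
    (ContMDiff.sum_section fun i _ => (contMDiff_inner (he i) hW).smul_section (he i))
  have hPx : P x = w := by simp [P, hWx, hw]
  have hg : CMDiff ∞ (fun y => inner ℝ (P y) (P y)) := contMDiff_inner hP hP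
  have hpos : ∀ᶠ y in 𝓝 x, 0 < inner ℝ (P y) (P y) := by
    refine hg.continuous.continuousAt.eventually (lt_mem_nhds ?_)
    change 0 < inner ℝ (P x) (P x)
    rw [hPx]
    exact real_inner_self_pos.2 hw0
  -- Normalising is known to be smooth only where `P ≠ 0`, so `Q` is afterwards replaced by a global
  -- field with the same germ at `x`.
  let Q : Π x : M, TangentSpace I x := (fun y => (√(inner ℝ (P y) (P y)))⁻¹) • P
  have hQ : ∀ᶠ y in 𝓝 x, CMDiffAt ∞ (T% Q) y := by
    filter_upwards [hpos] with y hy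
    refine ContMDiffAt.smul_section ?_ (hP y)
    have hs : ContDiffAt ℝ ∞ (fun t : ℝ => (√t)⁻¹) (inner ℝ (P y) (P y)) :=
      (Real.contDiffAt_sqrt hy.ne').inv (Real.sqrt_pos.2 hy).ne'
    exact ContMDiffAt.comp (g := fun t : ℝ => (√t)⁻¹) y hs.contMDiffAt (hg y)
  obtain ⟨Z, hZ, hZQ⟩ := exists_contMDiff_eventuallyEq hQ
  refine ⟨Z, hZ, ?_⟩
  filter_upwards [hZQ, hpos, hon] with y hy hposy hony
  have hn : 0 < ‖P y‖ := by
    rw [norm_pos_iff]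
    exact real_inner_self_pos.1 hposy
  have hs : √(inner ℝ (P y) (P y)) = ‖P y‖ := by
    rw [real_inner_self_eq_norm_sq, Real.sqrt_sq hn.le]
  rw [hy]
  constructor
  · simp only [Q, Pi.smul_apply', hs, norm_smul, norm_inv, norm_norm]
    exact inv_mul_cancel₀ hn.ne'
  · intro i
    have : inner ℝ (e i y) (P y) = 0 := by
      simp only [P, inner_sub_right, inner_sum, inner_smul_right]
      rw [Finset.sum_eq_single i]
      · simp [hony.1 i]
      · intro j _ hj
        simp [hony.2 hj.symm]
      · simp
    simp [Q, inner_smul_right, this]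

variable (I E) in
/-- Around every point there is a local orthonormal frame of globally smooth vector fields. -/
theorem exists_orthonormal_frame_at (x : M) :
    ∃ e : Fin (Module.finrank ℝ E) → Π x : M, TangentSpace I x, (∀ i, CMDiff ∞ (T% (e i))) ∧
      ∀ᶠ y in 𝓝 x, Orthonormal ℝ (fun i => e i y) := by
  suffices ∀ k ≤ Module.finrank ℝ E, ∃ e : Fin k → Π x : M, TangentSpace I x,
      (∀ i, CMDiff ∞ (T% (e i))) ∧ ∀ᶠ y in 𝓝 x, Orthonormal ℝ (fun i => e i y) from
    this _ le_rfl
  intro k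
  induction k with
  | zero => exact fun _ => ⟨Fin.elim0, fun i => i.elim0, .of_forall fun y => by simp⟩
  | succ k ih =>
    intro hk
    obtain ⟨e, he, hon⟩ := ih (by omega)
    obtain ⟨W, hW, h⟩ := exists_unit_field_orthogonal he hon (by simpa using hk)
    refine ⟨Fin.cons W e, fun i => ?_, ?_⟩
    · refine Fin.cases ?_ (fun j => ?_) i
      · simpa using hW
      · simpa using he j
    · filter_upwards [hon, h] with y hy hWy
      rw [orthonormal_iff_ite] at hy ⊢
      intro i j
      refine Fin.cases ?_ (fun i => ?_) i <;> refine Fin.cases ?_ (fun j => ?_) j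
      · simp [hWy.1]
      · simp [real_inner_comm (e j y), hWy.2 j, (Fin.succ_ne_zero j).symm]
      · simp [hWy.2 i]
      · simpa using hy i j

/-- A vector field is smooth if its inner products with all smooth vector fields are smooth. -/
theorem contMDiff_of_inner {V : Π x : M, TangentSpace I x}
    (hV : ∀ Z : Π x : M, TangentSpace I x, CMDiff ∞ (T% Z) →
      CMDiff ∞ (fun y => inner ℝ (Z y) (V y))) : CMDiff ∞ (T% V) := by
  intro x
  obtain ⟨e, he, hon⟩ := exists_orthonormal_frame_at (E := E) I x
  have hs : CMDiff ∞ (T% (fun y => ∑ i, inner ℝ (e i y) (V y) • e i y)) :=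
    ContMDiff.sum_section fun i _ => (hV _ (he i)).smul_section (he i)
  refine (hs x).congr_of_eventuallyEq ?_
  filter_upwards [hon] with y hy
  have : FiniteDimensional ℝ (TangentSpace I y) := inferInstanceAs (FiniteDimensional ℝ E)
  obtain ⟨O, hO⟩ := exists_orthonormalBasis_coe_eq hy (Fintype.card_fin _)
  simpa [hO] using (O.sum_repr' (V y)).symm

/-- In dimension three, a smooth unit vector field can be completed to a locally orthonormal
frame. -/
theorem exists_orthonormal_frame (hdim : Module.finrank ℝ E = 3) {X : Π x : M, TangentSpace I x}
    (hX : CMDiff ∞ (T% X)) (hX1 : ∀ y, ‖X y‖ = 1) (x : M) :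
    ∃ e f : Π x : M, TangentSpace I x, CMDiff ∞ (T% e) ∧ CMDiff ∞ (T% f) ∧
      ∀ᶠ y in 𝓝 x, Orthonormal ℝ ![X y, e y, f y] := by
  obtain ⟨e, he, h1⟩ := exists_unit_field_orthogonal (e := fun _ : Unit => X) (x := x)
    (fun _ => hX) (Eventually.of_forall fun y => by simp [hX1]) (by simp [hdim])
  have h2 : ∀ᶠ y in 𝓝 x, Orthonormal ℝ (fun i : Fin 2 => (![X, e] : Fin 2 → _) i y) := by
    filter_upwards [h1] with y hy
    rw [orthonormal_iff_ite]
    intro i j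
    fin_cases i <;> fin_cases j <;> simp [hX1, hy.1, hy.2 (), real_inner_comm (X y)]
  obtain ⟨f, hf, h3⟩ := exists_unit_field_orthogonal
    (fun i => by fin_cases i <;> simp [hX, he]) h2 (by simp [hdim])
  refine ⟨e, f, he, hf, ?_⟩
  filter_upwards [h1, h3] with y h1 h3
  have h30 := h3.2 0
  have h31 := h3.2 1
  simp only [Matrix.cons_val_zero, Matrix.cons_val_one] at h30 h31
  rw [orthonormal_iff_ite]
  intro i j
  fin_cases i <;> fin_cases j <;>
    simp [hX1, h1.1, h1.2 (), h3.1, h30, h31, real_inner_comm (X y), real_inner_comm (e y)]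

end OrthonormalFrame

/-! ### Covariant derivatives and the symmetries of the curvature -/

section CovDeriv

variable {E : Type*} [NormedAddCommGroup E] [NormedSpace ℝ E] [FiniteDimensional ℝ E]
  {H : Type*} [TopologicalSpace H] {I : ModelWithCorners ℝ E H}
  {M : Type*} [TopologicalSpace M] [ChartedSpace H M] [IsManifold I ∞ M]
  [RiemannianBundle (fun x : M => TangentSpace I x)]
  [IsContMDiffRiemannianBundle I ∞ E (fun x : M => TangentSpace I x)]

/-- The vector field `∇_V Y`. -/
noncomputable def covDeriv (V Y : Π x : M, TangentSpace I x) (x : M) : TangentSpace I x :=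
  leviCivita I M Y x (V x)

theorem curvature_eq_covDeriv (X Y Z : Π x : M, TangentSpace I x) (x : M) :
    curvature X Y Z x = covDeriv X (covDeriv Y Z) x - covDeriv Y (covDeriv X Z) x
      - covDeriv (mlieBracket I X Y) Z x :=
  rfl

theorem covDeriv_metric {V Y Z : Π x : M, TangentSpace I x} (hV : CMDiff ∞ (T% V))
    (hY : CMDiff ∞ (T% Y)) (hZ : CMDiff ∞ (T% Z)) (x : M) :
    d% (fun y => inner ℝ (Y y) (Z y)) x (V x) =
      inner ℝ (covDeriv V Y x) (Z x) + inner ℝ (Y x) (covDeriv V Z x) :=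
  leviCivita_metric (ContMDiff.mdiffAt_section hV x) (ContMDiff.mdiffAt_section hY x)
    (ContMDiff.mdiffAt_section hZ x)

theorem covDeriv_torsionFree {V Y : Π x : M, TangentSpace I x} (hV : CMDiff ∞ (T% V))
    (hY : CMDiff ∞ (T% Y)) (x : M) :
    covDeriv V Y x - covDeriv Y V x = mlieBracket I V Y x :=
  leviCivita_torsionFree (ContMDiff.mdiffAt_section hV x) (ContMDiff.mdiffAt_section hY x)

theorem mlieBracket_eq_covDeriv {V Y : Π x : M, TangentSpace I x} (hV : CMDiff ∞ (T% V))
    (hY : CMDiff ∞ (T% Y)) : mlieBracket I V Y = covDeriv V Y - covDeriv Y V :=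
  funext fun x => (covDeriv_torsionFree hV hY x).symm

theorem covDeriv_add_right (V : Π x : M, TangentSpace I x) {Y Z : Π x : M, TangentSpace I x}
    (hY : CMDiff ∞ (T% Y)) (hZ : CMDiff ∞ (T% Z)) :
    covDeriv V (Y + Z) = covDeriv V Y + covDeriv V Z := by
  funext x
  have := (leviCivita I M).isCovariantDerivativeOnUniv.add (ContMDiff.mdiffAt_section hY x)
    (ContMDiff.mdiffAt_section hZ x)
  exact congrArg (fun A : TangentSpace I x →L[ℝ] TangentSpace I x => A (V x)) this

theorem covDeriv_sub_right (V : Π x : M, TangentSpace I x) {Y Z : Π x : M, TangentSpace I x}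
    (hY : CMDiff ∞ (T% Y)) (hZ : CMDiff ∞ (T% Z)) :
    covDeriv V (Y - Z) = covDeriv V Y - covDeriv V Z := by
  have h := covDeriv_add_right V (hY.sub_section hZ) hZ
  rw [eq_sub_iff_add_eq, ← h]
  congr 1
  exact sub_add_cancel Y Z

theorem covDeriv_add_left (V W Y : Π x : M, TangentSpace I x) :
    covDeriv (V + W) Y = covDeriv V Y + covDeriv W Y := by
  funext x; simp [covDeriv]

theorem covDeriv_sub_left (V W Y : Π x : M, TangentSpace I x) :
    covDeriv (V - W) Y = covDeriv V Y - covDeriv W Y := by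
  funext x; simp [covDeriv]

variable [T2Space M]

/-- By the Koszul formula, the inner product with any smooth field is a smooth function. -/
theorem contMDiff_covDeriv {V Y : Π x : M, TangentSpace I x}
    (hV : CMDiff ∞ (T% V)) (hY : CMDiff ∞ (T% Y)) : CMDiff ∞ (T% (covDeriv V Y)) := by
  refine contMDiff_of_inner fun Z hZ => ?_
  have h : (fun y => inner ℝ (Z y) (covDeriv V Y y)) = fun y => (1 / 2 : ℝ) * koszul V Y Z y := by
    funext y
    rw [← two_mul_inner_leviCivita (ContMDiff.mdiffAt_section hV y)
      (ContMDiff.mdiffAt_section hY y) (ContMDiff.mdiffAt_section hZ y), real_inner_comm]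
    simp [covDeriv]
  rw [h]
  refine contMDiff_const.mul ?_
  have h1 := contMDiff_mvfderiv_apply (contMDiff_inner hY hZ) hV
  have h2 := contMDiff_mvfderiv_apply (contMDiff_inner hZ hV) hY
  have h3 := contMDiff_mvfderiv_apply (contMDiff_inner hV hY) hZ
  have h4 := contMDiff_inner (contMDiff_mlieBracket hV hY) hZ
  have h5 := contMDiff_inner (contMDiff_mlieBracket hV hZ) hY
  have h6 := contMDiff_inner (contMDiff_mlieBracket hY hZ) hV
  exact ((((h1.add h2).sub h3).add h4).sub h5).sub h6

theorem curvature_swap {X Y : Π x : M, TangentSpace I x} (Z : Π x : M, TangentSpace I x) (x : M) :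
    curvature X Y Z x = - curvature Y X Z x := by
  have : mlieBracket I X Y x = - mlieBracket I Y X x := mlieBracket_swap_apply
  simp only [curvature, this, map_neg]
  abel

/-- Without torsion, brackets are differences of covariant derivatives, and the Jacobi identity
becomes this one. -/
theorem curvature_bianchi {X Y Z : Π x : M, TangentSpace I x} (hX : CMDiff ∞ (T% X))
    (hY : CMDiff ∞ (T% Y)) (hZ : CMDiff ∞ (T% Z)) (x : M) :
    curvature X Y Z x + curvature Y Z X x + curvature Z X Y x = 0 := by
  have key : ∀ {P Q R : Π x : M, TangentSpace I x}, CMDiff ∞ (T% P) → CMDiff ∞ (T% Q) →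
      CMDiff ∞ (T% R) → mlieBracket I P (mlieBracket I Q R) x =
        covDeriv P (covDeriv Q R) x - covDeriv P (covDeriv R Q) x
          - covDeriv (mlieBracket I Q R) P x := by
    intro P Q R hP hQ hR
    rw [← covDeriv_torsionFree hP (contMDiff_mlieBracket hQ hR), mlieBracket_eq_covDeriv hQ hR,
      covDeriv_sub_right P (contMDiff_covDeriv hQ hR) (contMDiff_covDeriv hR hQ)]
    rfl
  have hj := mlieBracket_jacobi hX hY hZ x
  have e1 : mlieBracket I (mlieBracket I X Y) Z x = - mlieBracket I Z (mlieBracket I X Y) x :=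
    mlieBracket_swap_apply
  have e2 : mlieBracket I X Z = - mlieBracket I Z X := mlieBracket_swap
  have e3 : mlieBracket I Y (- mlieBracket I Z X) x = - mlieBracket I Y (mlieBracket I Z X) x := by
    have : CompleteSpace E := FiniteDimensional.complete ℝ E
    have := mlieBracket_const_smul_right (I := I) (V := Y) (c := (-1 : ℝ))
      (ContMDiff.mdiffAt_section (contMDiff_mlieBracket hZ hX) x)
    simpa using this
  rw [e1, e2, e3, key hX hY hZ, key hZ hX hY, key hY hZ hX, ← sub_eq_zero] at hj
  simp only [curvature_eq_covDeriv]
  rw [← hj]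
  abel

/-- The auxiliary nonvanishing field exists unless the tangent space at `x` is trivial, and then
both sides are zero. -/
theorem mvfderiv_mlieBracket_eq {f : M → ℝ} {U V : Π x : M, TangentSpace I x}
    (hf : CMDiff ∞ f) (hU : CMDiff ∞ (T% U)) (hV : CMDiff ∞ (T% V)) (x : M) :
    d% f x (mlieBracket I U V x) =
      d% (fun y => d% f y (V y)) x (U x) - d% (fun y => d% f y (U y)) x (V x) := by
  by_cases h : ∃ w : TangentSpace I x, w ≠ 0
  · obtain ⟨w, hw⟩ := h
    obtain ⟨W, hW, hWx⟩ := exists_contMDiff_apply_eq x w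
    exact mvfderiv_mlieBracket hf hU hV hW (hWx ▸ hw)
  · push Not at h
    simp [h (U x), h (V x), h (mlieBracket I U V x)]

/-- Differentiate `⟨Z, W⟩` twice by metric compatibility and antisymmetrise in `X`, `Y`: the mixed
terms cancel, and the bracket term is the commutator acting on `⟨Z, W⟩`. -/
theorem inner_curvature_skew {X Y Z W : Π x : M, TangentSpace I x} (hX : CMDiff ∞ (T% X))
    (hY : CMDiff ∞ (T% Y)) (hZ : CMDiff ∞ (T% Z)) (hW : CMDiff ∞ (T% W)) (x : M) :
    inner ℝ (curvature X Y Z x) (W x) = - inner ℝ (curvature X Y W x) (Z x) := by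
  have key : ∀ {P Q : Π x : M, TangentSpace I x}, CMDiff ∞ (T% P) → CMDiff ∞ (T% Q) →
      d% (fun y => d% (fun y => inner ℝ (Z y) (W y)) y (Q y)) x (P x) =
        inner ℝ (covDeriv P (covDeriv Q Z) x) (W x)
          + inner ℝ (covDeriv Q Z x) (covDeriv P W x)
          + (inner ℝ (covDeriv P Z x) (covDeriv Q W x)
            + inner ℝ (Z x) (covDeriv P (covDeriv Q W) x)) := by
    intro P Q hP hQ
    have h : (fun y => d% (fun y => inner ℝ (Z y) (W y)) y (Q y)) =
        (fun y => inner ℝ (covDeriv Q Z y) (W y) + inner ℝ (Z y) (covDeriv Q W y)) :=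
      funext fun y => covDeriv_metric hQ hZ hW y
    have hQZ := contMDiff_covDeriv hQ hZ
    have hQW := contMDiff_covDeriv hQ hW
    rw [h, mvfderiv_fun_add ((contMDiff_inner hQZ hW).mdifferentiable (by simp) x)
      ((contMDiff_inner hZ hQW).mdifferentiable (by simp) x), add_apply,
      covDeriv_metric hP hQZ hW, covDeriv_metric hP hZ hQW]
  have h := mvfderiv_mlieBracket_eq (contMDiff_inner hZ hW) hX hY x
  rw [key hX hY, key hY hX, covDeriv_metric (contMDiff_mlieBracket hX hY) hZ hW] at h
  simp only [curvature_eq_covDeriv, inner_sub_left]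
  rw [real_inner_comm (Z x) (covDeriv X (covDeriv Y W) x),
    real_inner_comm (Z x) (covDeriv Y (covDeriv X W) x),
    real_inner_comm (Z x) (covDeriv (mlieBracket I X Y) W x)]
  linarith

/-- The classical octahedron argument: four Bianchi identities combined with skew-symmetry in the
first and in the last pair. -/
theorem inner_curvature_pair_symm {X Y Z W : Π x : M, TangentSpace I x} (hX : CMDiff ∞ (T% X))
    (hY : CMDiff ∞ (T% Y)) (hZ : CMDiff ∞ (T% Z)) (hW : CMDiff ∞ (T% W)) (x : M) :
    inner ℝ (curvature X Y Z x) (W x) = inner ℝ (curvature Z W X x) (Y x) := by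
  have b : ∀ {P Q R S : Π x : M, TangentSpace I x}, CMDiff ∞ (T% P) → CMDiff ∞ (T% Q) →
      CMDiff ∞ (T% R) → inner ℝ (curvature P Q R x) (S x) + inner ℝ (curvature Q R P x) (S x)
        + inner ℝ (curvature R P Q x) (S x) = 0 := by
    intro P Q R S hP hQ hR
    rw [← inner_add_left, ← inner_add_left, curvature_bianchi hP hQ hR, inner_zero_left]
  have s : ∀ P Q R S : Π x : M, TangentSpace I x,
      inner ℝ (curvature P Q R x) (S x) = - inner ℝ (curvature Q P R x) (S x) := by
    intro P Q R S
    rw [curvature_swap, inner_neg_left]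
  have b1 := b (S := W) hX hY hZ
  have b2 := b (S := X) hY hZ hW
  have b3 := b (S := Y) hZ hW hX
  have b4 := b (S := Z) hW hX hY
  have k1 := inner_curvature_skew hX hY hZ hW x
  have k2 := inner_curvature_skew hY hZ hX hW x
  have k3 := inner_curvature_skew hZ hX hY hW x
  have k4 := inner_curvature_skew hY hW hZ hX x
  have k5 := inner_curvature_skew hZ hW hY hX x
  have k6 := inner_curvature_skew hW hX hZ hY x
  have s1 := s W Y Z X
  have s2 := s W X Z Y
  have s3 := s X Y W Z
  have s4 := s X Z W Y
  have s5 := s X W Z Y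
  linarith

end CovDeriv

/-! ### Constant curvature and the Riccati equation -/

section ConstantCurvature

variable {E : Type*} [NormedAddCommGroup E] [NormedSpace ℝ E] [FiniteDimensional ℝ E]
  {H : Type*} [TopologicalSpace H] {I : ModelWithCorners ℝ E H}
  {M : Type*} [TopologicalSpace M] [ChartedSpace H M] [IsManifold I ∞ M]
  [RiemannianBundle (fun x : M => TangentSpace I x)]
  [IsContMDiffRiemannianBundle I ∞ E (fun x : M => TangentSpace I x)]

theorem HasConstantSectionalCurvature.inner_curvature {c : ℝ}
    (hc : HasConstantSectionalCurvature I M c) {X Y : Π x : M, TangentSpace I x}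
    (hX : CMDiff ∞ (T% X)) (hY : CMDiff ∞ (T% Y)) {x : M} (hX0 : X x ≠ 0) (hY0 : Y x ≠ 0)
    (hXY : inner ℝ (X x) (Y x) = 0) :
    inner ℝ (curvature X Y Y x) (X x) =
      c * (inner ℝ (X x) (X x) * inner ℝ (Y x) (Y x)) := by
  have hli : LinearIndependent ℝ ![X x, Y x] := by
    refine linearIndependent_of_ne_zero_of_inner_eq_zero ?_ ?_
    · intro i
      fin_cases i
      · exact hX0
      · exact hY0
    · intro i j hij
      fin_cases i <;> fin_cases j
      · exact absurd rfl hij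
      · exact hXY
      · exact (real_inner_comm _ _).trans hXY
      · exact absurd rfl hij
  have h := hc x X Y hX hY hli
  rw [sectionalCurvature, hXY, div_eq_iff (by simpa using ⟨hX0, hY0⟩)] at h
  rw [h]
  ring

variable [T2Space M]

/-- The only linearity of the curvature that the polarisation below requires. -/
theorem curvature_add_left {X Y : Π x : M, TangentSpace I x} (hX : CMDiff ∞ (T% X))
    (hY : CMDiff ∞ (T% Y)) {Z W : Π x : M, TangentSpace I x}
    (hW : CMDiff ∞ (T% W)) (x : M) :
    curvature (X + Y) Z W x = curvature X Z W x + curvature Y Z W x := by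
  have : CompleteSpace E := FiniteDimensional.complete ℝ E
  have h : mlieBracket I (X + Y) Z = mlieBracket I X Z + mlieBracket I Y Z := funext fun y =>
    mlieBracket_add_left (ContMDiff.mdiffAt_section hX y) (ContMDiff.mdiffAt_section hY y)
  simp only [curvature_eq_covDeriv, h, covDeriv_add_left,
    covDeriv_add_right Z (contMDiff_covDeriv hX hW) (contMDiff_covDeriv hY hW), Pi.add_apply]
  abel

/-- In constant curvature, `⟨R(Y, X) X, Z⟩ = 0` for `X`, `Y`, `Z` orthonormal at `x`. -/
theorem HasConstantSectionalCurvature.inner_curvature_orthogonal {c : ℝ}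
    (hc : HasConstantSectionalCurvature I M c) {X Y Z : Π x : M, TangentSpace I x}
    (hX : CMDiff ∞ (T% X)) (hY : CMDiff ∞ (T% Y)) (hZ : CMDiff ∞ (T% Z)) {x : M}
    (hX0 : X x ≠ 0) (hY0 : Y x ≠ 0) (hZ0 : Z x ≠ 0)
    (hYX : inner ℝ (Y x) (X x) = 0) (hZX : inner ℝ (Z x) (X x) = 0)
    (hYZ : inner ℝ (Y x) (Z x) = 0) :
    inner ℝ (curvature Y X X x) (Z x) = 0 := by
  have hZY : inner ℝ (Z x) (Y x) = 0 := (real_inner_comm _ _).trans hYZ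
  have hYZ0 : (Y + Z) x ≠ 0 := by
    intro h
    have h' : inner ℝ (Y x) ((Y + Z) x) = 0 := by rw [h, inner_zero_right]
    rw [Pi.add_apply, inner_add_right, hYZ, add_zero] at h'
    exact hY0 (inner_self_eq_zero.1 h')
  have h1 := hc.inner_curvature hY hX hY0 hX0 hYX
  have h2 := hc.inner_curvature hZ hX hZ0 hX0 hZX
  have h3 := hc.inner_curvature (hY.add_section hZ) hX hYZ0 hX0
    (by rw [Pi.add_apply, inner_add_left, hYX, hZX, add_zero])
  -- Expanding `h3` and subtracting `h1` and `h2` leaves two cross terms with sum zero; `h4` and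
  -- `h5` show that they are equal.
  have h4 := inner_curvature_pair_symm hY hX hX hZ x
  have h5 : inner ℝ (curvature X Z Y x) (X x) = inner ℝ (curvature Z X X x) (Y x) := by
    rw [curvature_swap, inner_neg_left, inner_curvature_skew hZ hX hY hX, neg_neg]
  rw [curvature_add_left hY hZ hX] at h3
  simp only [Pi.add_apply, inner_add_left, inner_add_right, hYZ, hZY] at h3
  linarith

/-- Makes the connection coefficients of a frame skew; local constancy suffices, as frames are
orthonormal only near a point. -/
theorem inner_covDeriv_of_inner_eq_const {V P Q : Π x : M, TangentSpace I x}
    (hV : CMDiff ∞ (T% V)) (hP : CMDiff ∞ (T% P)) (hQ : CMDiff ∞ (T% Q)) {x : M} {r : ℝ}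
    (h : ∀ᶠ y in 𝓝 x, inner ℝ (P y) (Q y) = r) :
    inner ℝ (covDeriv V P x) (Q x) + inner ℝ (P x) (covDeriv V Q x) = 0 := by
  have h1 : d% (fun y => inner ℝ (P y) (Q y)) x = 0 := by
    have h2 := EventuallyEq.mfderiv_eq (I := I) (I' := 𝓘(ℝ, ℝ))
      (f₁ := fun y => inner ℝ (P y) (Q y)) (f := fun _ => r) h
    rw [mvfderiv, h2, mfderiv_const]
    exact ContinuousLinearMap.comp_zero _
  rw [← covDeriv_metric hV hP hQ, h1, zero_apply]

/-- The matrix entry `⟨P, ∇_Q X⟩` of `v ↦ ∇_v X` with respect to vector fields `P` and `Q`. -/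
noncomputable def shapeEntry (X P Q : Π x : M, TangentSpace I x) (y : M) : ℝ :=
  inner ℝ (P y) (covDeriv Q X y)

theorem IsGeodesicField.contMDiff_shapeEntry {X P Q : Π x : M, TangentSpace I x}
    (hX : IsGeodesicField X) (hP : CMDiff ∞ (T% P)) (hQ : CMDiff ∞ (T% Q)) :
    CMDiff ∞ (shapeEntry X P Q) :=
  contMDiff_inner hP (contMDiff_covDeriv hQ hX.smooth)

/-- The derivative of the matrix entries `⟨P, ∇_Q X⟩` along a geodesic field `X`. -/
theorem IsGeodesicField.mvfderiv_shapeEntry {X P Q : Π x : M, TangentSpace I x}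
    (hX : IsGeodesicField X) (hP : CMDiff ∞ (T% P)) (hQ : CMDiff ∞ (T% Q)) (x : M) :
    d% (shapeEntry X P Q) x (X x) =
      inner ℝ (covDeriv X P x) (leviCivita I M X x (Q x))
        + inner ℝ (P x) (leviCivita I M X x (covDeriv X Q x))
        - inner ℝ (P x) (leviCivita I M X x (leviCivita I M X x (Q x)))
        - inner ℝ (curvature Q X X x) (P x) := by
  have h0 : covDeriv X X = 0 := funext fun y => hX.leviCivita_self y
  have h1 : covDeriv Q (0 : Π x : M, TangentSpace I x) x = 0 := by
    have := covDeriv_sub_right Q hX.smooth hX.smooth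
    rw [sub_self, sub_self] at this
    exact congrFun this x
  -- Commute the derivatives, using `∇_X X = 0` and `[X, Q] = ∇_X Q - ∇_Q X`; the second summand of
  -- the bracket produces the quadratic term.
  have h2 : covDeriv X (covDeriv Q X) x =
      leviCivita I M X x (covDeriv X Q x)
        - leviCivita I M X x (leviCivita I M X x (Q x)) - curvature Q X X x := by
    rw [curvature_swap, curvature_eq_covDeriv, h0, h1, mlieBracket_eq_covDeriv hX.smooth hQ,
      covDeriv_sub_left]
    simp only [Pi.sub_apply, covDeriv]
    abel
  unfold shapeEntry
  rw [covDeriv_metric hX.smooth hP (contMDiff_covDeriv hQ hX.smooth), h2, inner_sub_right,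
    inner_sub_right, real_inner_comm (P x) (curvature Q X X x)]
  simp only [covDeriv]
  ring

/-- The Riccati equation for the shape operator of a geodesic field, in a local orthonormal frame
completing the field. -/
theorem IsGeodesicField.riccati (hdim : Module.finrank ℝ E = 3) {c : ℝ}
    (hc : HasConstantSectionalCurvature I M c) {X e f : Π x : M, TangentSpace I x}
    (hX : IsGeodesicField X) (he : CMDiff ∞ (T% e)) (hf : CMDiff ∞ (T% f)) {x : M}
    (hon : ∀ᶠ y in 𝓝 x, Orthonormal ℝ ![X y, e y, f y]) :
    ∃ w : ℝ,
      d% (shapeEntry X e e) x (X x) =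
        w * (shapeEntry X e f x + shapeEntry X f e x)
          - (shapeEntry X e e x ^ 2 + shapeEntry X e f x * shapeEntry X f e x) - c ∧
      d% (shapeEntry X e f) x (X x) =
        w * (shapeEntry X f f x - shapeEntry X e e x)
          - shapeEntry X e f x * (shapeEntry X e e x + shapeEntry X f f x) ∧
      d% (shapeEntry X f e) x (X x) =
        w * (shapeEntry X f f x - shapeEntry X e e x)
          - shapeEntry X f e x * (shapeEntry X e e x + shapeEntry X f f x) ∧
      d% (shapeEntry X f f) x (X x) =
        - w * (shapeEntry X e f x + shapeEntry X f e x)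
          - (shapeEntry X f f x ^ 2 + shapeEntry X e f x * shapeEntry X f e x) - c := by
  have hcomp : ∀ i j : Fin 3, ∀ᶠ y in 𝓝 x, inner ℝ (![X y, e y, f y] i) (![X y, e y, f y] j) =
      if i = j then (1 : ℝ) else 0 := by
    intro i j
    filter_upwards [hon] with y hy
    exact orthonormal_iff_ite.1 hy i j
  have hXe := hcomp 0 1
  have hXf := hcomp 0 2
  have hee := hcomp 1 1
  have hef := hcomp 1 2
  have hff := hcomp 2 2
  have hfe := hcomp 2 1
  simp only [Matrix.cons_val] at hXe hXf hee hef hff hfe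
  have hexp := fun v => orthonormal_triple_expansion (E := TangentSpace I x) hdim hon.self_of_nhds v
  have kXe := inner_covDeriv_of_inner_eq_const hX.smooth hX.smooth he hXe
  have kXf := inner_covDeriv_of_inner_eq_const hX.smooth hX.smooth hf hXf
  have kee := inner_covDeriv_of_inner_eq_const hX.smooth he he hee
  have kef := inner_covDeriv_of_inner_eq_const hX.smooth he hf hef
  have kff := inner_covDeriv_of_inner_eq_const hX.smooth hf hf hff
  have hXX : covDeriv X X x = 0 := hX.leviCivita_self x
  rw [hXX, inner_zero_left, zero_add] at kXe kXf
  rw [real_inner_comm] at kee kff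
  have kee' : inner ℝ (e x) (covDeriv X e x) = 0 := by linarith
  have kff' : inner ℝ (f x) (covDeriv X f x) = 0 := by linarith
  -- The rotation speed of the frame `(e, f)` along `X`. The frame need not be parallel: the `w`
  -- terms form a commutator and drop out of the trace and the determinant.
  obtain ⟨w, hw⟩ : ∃ w, w = inner ℝ (f x) (covDeriv X e x) := ⟨_, rfl⟩
  have kef' : inner ℝ (e x) (covDeriv X f x) = - w := by
    rw [hw, real_inner_comm (covDeriv X e x)]; linarith
  have hwe : covDeriv X e x = w • f x := by
    rw [hexp (covDeriv X e x), kXe, kee', ← hw]; simp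
  have hwf : covDeriv X f x = - w • e x := by
    rw [hexp (covDeriv X f x), kXf, kff', kef']; simp
  have hXe := hXe.self_of_nhds
  have hXf := hXf.self_of_nhds
  have he1 : ‖e x‖ = 1 := hon.self_of_nhds.1 1
  have hef := hef.self_of_nhds
  have hf1 : ‖f x‖ = 1 := hon.self_of_nhds.1 2
  have hfe := hfe.self_of_nhds
  simp only [Fin.reduceEq, if_false] at hXe hXf hef hfe
  have hX0 : X x ≠ 0 := fun h => by simpa [h] using hX.norm_eq_one x
  have he0 : e x ≠ 0 := fun h => by simp [h] at he1
  have hf0 : f x ≠ 0 := fun h => by simp [h] at hf1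
  have hfX : inner ℝ (f x) (X x) = 0 := (real_inner_comm _ _).trans hXf
  have heX : inner ℝ (e x) (X x) = 0 := (real_inner_comm _ _).trans hXe
  have cee : inner ℝ (curvature e X X x) (e x) = c := by
    rw [hc.inner_curvature he hX.smooth he0 hX0 heX]
    simp [hX.norm_eq_one x, he1]
  have cff : inner ℝ (curvature f X X x) (f x) = c := by
    rw [hc.inner_curvature hf hX.smooth hf0 hX0 hfX]
    simp [hX.norm_eq_one x, hf1]
  have cef := hc.inner_curvature_orthogonal hX.smooth he hf hX0 he0 hf0 heX hfX hef
  have cfe := hc.inner_curvature_orthogonal hX.smooth hf he hX0 hf0 he0 hfX heX hfe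
  have hAe : leviCivita I M X x (e x) = shapeEntry X e e x • e x + shapeEntry X f e x • f x := by
    have := hexp (leviCivita I M X x (e x))
    rwa [hX.inner_leviCivita, zero_smul, zero_add] at this
  have hAf : leviCivita I M X x (f x) = shapeEntry X e f x • e x + shapeEntry X f f x • f x := by
    have := hexp (leviCivita I M X x (f x))
    rwa [hX.inner_leviCivita, zero_smul, zero_add] at this
  refine ⟨w, ?_, ?_, ?_, ?_⟩ <;> rw [hX.mvfderiv_shapeEntry (by assumption) (by assumption)] <;>
    simp only [hwe, hwf, cee, cff, cef, cfe, hAe, hAf, map_add, map_smul, inner_add_right,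
      inner_smul_right, inner_smul_left, hef, hfe, he1, hf1, real_inner_self_eq_norm_sq] <;>
    simp <;> ring

end ConstantCurvature

/-! ### The scalar equations for trace and determinant -/

section ScalarRiccati

/-- A solution of `q' = -T q` that vanishes at `0` vanishes identically. -/
theorem eq_zero_of_hasDerivAt_neg_mul {T q : ℝ → ℝ} (hT : Continuous T)
    (hq : ∀ t, HasDerivAt q (-T t * q t) t) (h0 : q 0 = 0) (t : ℝ) : q t = 0 := by
  have hF : ∀ t, HasDerivAt (fun t => ∫ s in (0 : ℝ)..t, T s) (T t) t := fun t =>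
    intervalIntegral.integral_hasDerivAt_right (hT.intervalIntegrable _ _)
      hT.aestronglyMeasurable.stronglyMeasurableAtFilter hT.continuousAt
  -- `exp (∫ T)` is an integrating factor.
  have hG : ∀ t, HasDerivAt (fun t => Real.exp (∫ s in (0 : ℝ)..t, T s) * q t) 0 t := fun t => by
    convert! (hF t).exp.mul (hq t) using 1
    ring
  have h := is_const_of_deriv_eq_zero (fun t => (hG t).differentiableAt) (fun t => (hG t).deriv) t 0
  rw [h0, mul_zero] at h
  exact (mul_eq_zero.1 h).resolve_left (Real.exp_ne_zero _)

/-- Let `T`, `D` be the trace and the determinant of a solution of the Riccati equation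
`β' = -β² - c` on all of `ℝ`, and let `μ` be an eigenvalue of `β 0`. Then the solution of
`s'' = - c s` with `s 0 = 1`, `s' 0 = μ` has no simple zeros. -/
theorem deriv_eq_zero_of_riccati {c μ : ℝ} {T D s s' : ℝ → ℝ}
    (hT : ∀ t, HasDerivAt T (-T t ^ 2 + 2 * D t - 2 * c) t)
    (hD : ∀ t, HasDerivAt D (-(D t + c) * T t) t)
    (hμ : μ ^ 2 - T 0 * μ + D 0 = 0)
    (hs : ∀ t, HasDerivAt s (s' t) t) (hs' : ∀ t, HasDerivAt s' (-c * s t) t)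
    (h0 : s 0 = 1) (h0' : s' 0 = μ) (t : ℝ) (hst : s t = 0) : s' t = 0 := by
  -- This function is `det(s' - s β)`; at `0` it is the characteristic polynomial of `β 0` evaluated
  -- at `μ`.
  have hq : ∀ t, HasDerivAt (fun t => s' t ^ 2 - T t * (s t * s' t) + D t * s t ^ 2)
      (-T t * (s' t ^ 2 - T t * (s t * s' t) + D t * s t ^ 2)) t := fun t => by
    convert! (((hs' t).pow 2).sub ((hT t).mul ((hs t).mul (hs' t)))).add
      ((hD t).mul ((hs t).pow 2)) using 1
    simp
    ring
  have hTc : Continuous T := continuous_iff_continuousAt.2 fun t => (hT t).continuousAt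
  have h := eq_zero_of_hasDerivAt_neg_mul hTc hq (by
    simp only [h0, h0']
    linear_combination hμ) t
  simpa [hst] using h

/-- In each excluded case the explicit solution `s` has a zero, and there `s'` is nonzero. -/
theorem riccati_eigenvalue {c μ : ℝ} {T D : ℝ → ℝ}
    (hT : ∀ t, HasDerivAt T (-T t ^ 2 + 2 * D t - 2 * c) t)
    (hD : ∀ t, HasDerivAt D (-(D t + c) * T t) t)
    (hμ : μ ^ 2 - T 0 * μ + D 0 = 0) :
    ¬ 0 < c ∧ (c = 0 → μ = 0) ∧ (c < 0 → |μ| ≤ √|c|) := by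
  refine ⟨fun hc => ?_, fun hc => ?_, fun hc => ?_⟩
  · set k := √c with hk
    have hk0 : 0 < k := Real.sqrt_pos.2 hc
    have hkk : c = k ^ 2 := (Real.sq_sqrt hc.le).symm
    have hlin : ∀ t, HasDerivAt (fun t => k * t) k t := fun t => by
      simpa using (hasDerivAt_id t).const_mul k
    have key := deriv_eq_zero_of_riccati hT hD hμ
      (s := fun t => Real.cos (k * t) + μ / k * Real.sin (k * t))
      (s' := fun t => -k * Real.sin (k * t) + μ * Real.cos (k * t))
      (fun t => by
        convert! (hlin t).cos.add ((hlin t).sin.const_mul (μ / k)) using 1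
        field_simp)
      (fun t => by
        convert! ((hlin t).sin.const_mul (-k)).add ((hlin t).cos.const_mul μ) using 1
        rw [hkk]
        field_simp
        ring)
      (by simp) (by simp)
    have hz : ∃ θ : ℝ, Real.cos θ + μ / k * Real.sin θ = 0 := by
      -- The function is `1` at `0` and `-1` at `π`.
      have h1 : ∃ θ ∈ Set.Icc (0 : ℝ) Real.pi, Real.cos θ + μ / k * Real.sin θ = 0 :=
        intermediate_value_Icc' Real.pi_pos.le (by fun_prop) (by simp)
      obtain ⟨θ, -, h⟩ := h1
      exact ⟨θ, h⟩
    obtain ⟨θ, hθ⟩ := hz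
    have h1 : k * (θ / k) = θ := by field_simp
    have h2 := key (θ / k) (by simpa only [h1] using hθ)
    simp only [h1] at h2
    have h3 : k * Real.cos θ + μ * Real.sin θ = 0 := by
      have := congrArg (k * ·) hθ
      simp only [mul_zero] at this
      rw [← this]
      field_simp
    -- `h2` and `h3` form a homogeneous linear system in `(cos θ, sin θ)` with determinant `±(k² +
    -- μ²)`, which would force both to vanish.
    have h4 := Real.sin_sq_add_cos_sq θ
    have h5 : Real.sin θ * (k ^ 2 + μ ^ 2) = 0 := by linear_combination μ * h3 - k * h2
    have h6 : Real.cos θ * (k ^ 2 + μ ^ 2) = 0 := by linear_combination k * h3 + μ * h2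
    have h7 : (k ^ 2 + μ ^ 2) ≠ 0 := by positivity
    rw [(mul_eq_zero.1 h5).resolve_right h7, (mul_eq_zero.1 h6).resolve_right h7] at h4
    norm_num at h4
  · by_contra hne
    have key := deriv_eq_zero_of_riccati hT hD hμ (s := fun t => 1 + μ * t) (s' := fun _ => μ)
      (fun t => by simpa using ((hasDerivAt_id t).const_mul μ).const_add 1)
      (fun t => by simpa [hc] using hasDerivAt_const t μ) (by simp) rfl
    exact hne (key (-μ⁻¹) (by field_simp; simp))
  · set k := √|c| with hk
    have hk0 : 0 < k := Real.sqrt_pos.2 (abs_pos.2 hc.ne)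
    have hkk : c = -k ^ 2 := by
      rw [hk, Real.sq_sqrt (abs_nonneg c), abs_of_neg hc, neg_neg]
    by_contra! hlt
    have hne : k ^ 2 < μ ^ 2 := by
      rw [← sq_abs μ]
      gcongr
    have hsum : μ + k ≠ 0 := fun h => by
      rw [show μ = -k by linarith] at hne
      simp at hne
    -- This quotient is the value of `exp (2kt)` at a zero of `s`; it is positive because `|μ| > k`.
    have hdiv : 0 < (μ - k) / (μ + k) := by
      rw [show (μ - k) / (μ + k) = (μ ^ 2 - k ^ 2) / (μ + k) ^ 2 by field_simp; ring]
      exact div_pos (sub_pos.2 hne) (by positivity)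
    have hexp : ∀ a t : ℝ, HasDerivAt (fun t => Real.exp (a * t)) (a * Real.exp (a * t)) t :=
      fun a t => by
        have : HasDerivAt (fun t => a * t) a t := by simpa using (hasDerivAt_id t).const_mul a
        simpa [mul_comm] using this.exp
    have key := deriv_eq_zero_of_riccati hT hD hμ
      (s := fun t => (k + μ) / (2 * k) * Real.exp (k * t) + (k - μ) / (2 * k) * Real.exp (-k * t))
      (s' := fun t => (k + μ) / 2 * Real.exp (k * t) - (k - μ) / 2 * Real.exp (-k * t))
      (fun t => by
        convert! ((hexp k t).const_mul _).add ((hexp (-k) t).const_mul _) using 1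
        field_simp
        ring)
      (fun t => by
        convert! ((hexp k t).const_mul _).sub ((hexp (-k) t).const_mul _) using 1
        rw [hkk]
        field_simp
        ring)
      (by simp; field_simp; ring) (by simp; ring)
    obtain ⟨t, ht⟩ : ∃ t, Real.exp (2 * k * t) = (μ - k) / (μ + k) :=
      ⟨Real.log ((μ - k) / (μ + k)) / (2 * k), by
        rw [mul_div_cancel₀ _ (by positivity), Real.exp_log hdiv]⟩
    have h1 : Real.exp (k * t) = (μ - k) / (μ + k) * Real.exp (-k * t) := by
      rw [← ht, ← Real.exp_add]
      ring_nf
    have h2 := key t (by simp only [h1]; field_simp; ring)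
    simp only [h1] at h2
    -- At the zero of `s`, the derivative `s'` equals `(μ - k) exp (-kt)`.
    have h3 : (μ - k) * Real.exp (-k * t) = 0 := by
      rw [← h2]
      field_simp
      ring
    have h4 : μ - k ≠ 0 := fun h => by simp [h] at hdiv
    exact (mul_ne_zero h4 (Real.exp_ne_zero _)) h3

end ScalarRiccati

/-! ### Trace and determinant of `β` along integral curves -/

section GeodesicField

variable {E : Type*} [NormedAddCommGroup E] [NormedSpace ℝ E] [FiniteDimensional ℝ E]
  {H : Type*} [TopologicalSpace H] {I : ModelWithCorners ℝ E H}
  {M : Type*} [TopologicalSpace M] [ChartedSpace H M] [IsManifold I ∞ M]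
  [RiemannianBundle (fun x : M => TangentSpace I x)]
  [IsContMDiffRiemannianBundle I ∞ E (fun x : M => TangentSpace I x)]

/-- The trace of the endomorphism `v ↦ ∇_v X` of the tangent space at `x`. -/
noncomputable def shapeTrace (X : Π x : M, TangentSpace I x) (x : M) : ℝ :=
  LinearMap.trace ℝ (TangentSpace I x) (leviCivita I M X x).toLinearMap

/-- The second elementary symmetric function of the eigenvalues of `v ↦ ∇_v X`. -/
noncomputable def shapeMinor (X : Π x : M, TangentSpace I x) (x : M) : ℝ :=
  (shapeTrace X x ^ 2 - LinearMap.trace ℝ (TangentSpace I x)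
    ((leviCivita I M X x).toLinearMap ∘ₗ (leviCivita I M X x).toLinearMap)) / 2

theorem IsGeodesicField.leviCivita_expansion (hdim : Module.finrank ℝ E = 3)
    {X e f : Π x : M, TangentSpace I x} (hX : IsGeodesicField X) {x : M}
    (hon : Orthonormal ℝ ![X x, e x, f x]) :
    leviCivita I M X x (e x) = shapeEntry X e e x • e x + shapeEntry X f e x • f x ∧
      leviCivita I M X x (f x) = shapeEntry X e f x • e x + shapeEntry X f f x • f x := by
  constructor
  · have := orthonormal_triple_expansion (E := TangentSpace I x) hdim hon
      (leviCivita I M X x (e x))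
    rwa [hX.inner_leviCivita, zero_smul, zero_add] at this
  · have := orthonormal_triple_expansion (E := TangentSpace I x) hdim hon
      (leviCivita I M X x (f x))
    rwa [hX.inner_leviCivita, zero_smul, zero_add] at this

/-- The `X` diagonal entry vanishes since `∇_v X ⟂ X`, so the trace on the whole tangent space,
which needs no frame, is that of `β`. -/
theorem IsGeodesicField.shapeTrace_eq (hdim : Module.finrank ℝ E = 3)
    {X e f : Π x : M, TangentSpace I x} (hX : IsGeodesicField X) {x : M}
    (hon : Orthonormal ℝ ![X x, e x, f x]) :
    shapeTrace X x = shapeEntry X e e x + shapeEntry X f f x := by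
  rw [shapeTrace, trace_eq_of_orthonormal_triple (E := TangentSpace I x) hdim hon]
  simp only [ContinuousLinearMap.coe_coe, hX.inner_leviCivita, zero_add]
  rfl

/-- The `X` row of the matrix is zero, so `(tr² - tr(A²)) / 2` reduces to the determinant of the
block of `β`. -/
theorem IsGeodesicField.shapeMinor_eq (hdim : Module.finrank ℝ E = 3)
    {X e f : Π x : M, TangentSpace I x} (hX : IsGeodesicField X) {x : M}
    (hon : Orthonormal ℝ ![X x, e x, f x]) :
    shapeMinor X x =
      shapeEntry X e e x * shapeEntry X f f x - shapeEntry X e f x * shapeEntry X f e x := by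
  obtain ⟨hAe, hAf⟩ := hX.leviCivita_expansion hdim hon
  have he : ‖e x‖ = 1 := hon.1 1
  have hf : ‖f x‖ = 1 := hon.1 2
  have hef : inner ℝ (e x) (f x) = 0 := hon.2 (show (1 : Fin 3) ≠ 2 by decide)
  have hfe : inner ℝ (f x) (e x) = 0 := hon.2 (show (2 : Fin 3) ≠ 1 by decide)
  rw [shapeMinor, hX.shapeTrace_eq hdim hon,
    trace_eq_of_orthonormal_triple (E := TangentSpace I x) hdim hon]
  simp only [LinearMap.comp_apply, ContinuousLinearMap.coe_coe, hX.inner_leviCivita, hAe, hAf,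
    map_add, map_smul, inner_add_right, inner_smul_right, real_inner_self_eq_norm_sq, he, hf, hef,
    hfe]
  ring

/-- A real eigenvalue of `β` is a root of its characteristic polynomial. -/
theorem IsGeodesicField.eigenvalue_beta (hdim : Module.finrank ℝ E = 3)
    {X e f : Π x : M, TangentSpace I x} (hX : IsGeodesicField X) {x : M}
    (hon : Orthonormal ℝ ![X x, e x, f x]) {μ : ℝ} (hμ : (beta X hX x).HasEigenvalue μ) :
    μ ^ 2 - shapeTrace X x * μ + shapeMinor X x = 0 := by
  obtain ⟨v, hv⟩ := hμ.exists_hasEigenvector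
  have hv0 : (v : TangentSpace I x) ≠ 0 := by simpa using hv.2
  have hv1 : leviCivita I M X x v = μ • (v : TangentSpace I x) :=
    congrArg Subtype.val hv.apply_eq_smul
  have hvX : inner ℝ (X x) (v : TangentSpace I x) = 0 :=
    Submodule.mem_orthogonal_singleton_iff_inner_right.1 v.2
  obtain ⟨hAe, hAf⟩ := hX.leviCivita_expansion hdim hon
  have he : ‖e x‖ = 1 := hon.1 1
  have hf : ‖f x‖ = 1 := hon.1 2
  have hef : inner ℝ (e x) (f x) = 0 := hon.2 (show (1 : Fin 3) ≠ 2 by decide)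
  have hfe : inner ℝ (f x) (e x) = 0 := hon.2 (show (2 : Fin 3) ≠ 1 by decide)
  have hexp := orthonormal_triple_expansion (E := TangentSpace I x) hdim hon v
  rw [hvX, zero_smul, zero_add] at hexp
  generalize inner ℝ (e x) (v : TangentSpace I x) = a at hexp
  generalize inner ℝ (f x) (v : TangentSpace I x) = b at hexp
  rw [hexp] at hv1 hv0
  have h1 := congrArg (fun u => inner ℝ (e x) u) hv1
  have h2 := congrArg (fun u => inner ℝ (f x) u) hv1
  simp only [hAe, hAf, map_add, map_smul, inner_add_right, inner_smul_right,
    real_inner_self_eq_norm_sq, he, hf, hef, hfe] at h1 h2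
  rw [hX.shapeTrace_eq hdim hon, hX.shapeMinor_eq hdim hon]
  -- Cramer's rule for `(μ - β) v = 0`: a nonzero determinant forces both coordinates of `v` to
  -- vanish.
  by_contra hne
  have ha : a = 0 := by
    refine (mul_eq_zero.1 (?_ : _ * a = 0)).resolve_left hne
    linear_combination (-(μ - shapeEntry X f f x)) * h1 - shapeEntry X e f x * h2
  have hb : b = 0 := by
    refine (mul_eq_zero.1 (?_ : _ * b = 0)).resolve_left hne
    linear_combination (-(μ - shapeEntry X e e x)) * h2 - shapeEntry X f e x * h1
  exact hv0 (by simp [ha, hb])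

theorem hasDerivAt_comp_integralCurve {X : Π x : M, TangentSpace I x} {γ : ℝ → M}
    (hγ : IsMIntegralCurve γ X) {g : M → ℝ} {t : ℝ} (hg : MDiffAt g (γ t)) :
    HasDerivAt (g ∘ γ) (d% g (γ t) (X (γ t))) t := by
  have h : HasFDerivAt (g ∘ γ)
      ((d% g (γ t)).comp ((1 : ℝ →L[ℝ] ℝ).smulRight (X (γ t))) : ℝ →L[ℝ] ℝ) t :=
    hasMFDerivAt_iff_hasFDerivAt.1 (hg.hasMFDerivAt.comp t (hγ t))
  have h1 : d% g (γ t) ((1 : ℝ) • X (γ t)) = d% g (γ t) (X (γ t)) := by rw [one_smul]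
  rw [← h1]
  exact h.hasDerivAt

variable [T2Space M]

/-- The frame is chosen anew around each `γ t`; this is harmless because trace and minor do not
depend on it. -/
theorem IsGeodesicField.hasDerivAt_shape (hdim : Module.finrank ℝ E = 3) {c : ℝ}
    (hc : HasConstantSectionalCurvature I M c) {X : Π x : M, TangentSpace I x}
    (hX : IsGeodesicField X) {γ : ℝ → M} (hγ : IsMIntegralCurve γ X) (t : ℝ) :
    HasDerivAt (shapeTrace X ∘ γ)
        (-shapeTrace X (γ t) ^ 2 + 2 * shapeMinor X (γ t) - 2 * c) t ∧
      HasDerivAt (shapeMinor X ∘ γ) (-(shapeMinor X (γ t) + c) * shapeTrace X (γ t)) t := by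
  obtain ⟨e, f, he, hf, hon⟩ := exists_orthonormal_frame hdim hX.smooth hX.norm_eq_one (γ t)
  obtain ⟨w, h11, h12, h21, h22⟩ := hX.riccati hdim hc he hf hon
  have hd : ∀ {P Q : Π x : M, TangentSpace I x}, CMDiff ∞ (T% P) → CMDiff ∞ (T% Q) →
      HasDerivAt (shapeEntry X P Q ∘ γ) (d% (shapeEntry X P Q) (γ t) (X (γ t))) t :=
    fun hP hQ => hasDerivAt_comp_integralCurve hγ
      ((hX.contMDiff_shapeEntry hP hQ).mdifferentiable (by simp) _)
  have d11 := hd he he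
  have d12 := hd he hf
  have d21 := hd hf he
  have d22 := hd hf hf
  rw [h11] at d11
  rw [h12] at d12
  rw [h21] at d21
  rw [h22] at d22
  have honγ := hγ.continuous.continuousAt.eventually hon
  have hT : shapeTrace X ∘ γ =ᶠ[𝓝 t] (shapeEntry X e e ∘ γ + shapeEntry X f f ∘ γ) := by
    filter_upwards [honγ] with s hs
    exact hX.shapeTrace_eq hdim hs
  have hD : shapeMinor X ∘ γ =ᶠ[𝓝 t] ((shapeEntry X e e ∘ γ) * (shapeEntry X f f ∘ γ) -
      (shapeEntry X e f ∘ γ) * (shapeEntry X f e ∘ γ)) := by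
    filter_upwards [honγ] with s hs
    exact hX.shapeMinor_eq hdim hs
  rw [hX.shapeTrace_eq hdim hon.self_of_nhds, hX.shapeMinor_eq hdim hon.self_of_nhds]
  constructor
  · refine HasDerivAt.congr_of_eventuallyEq ?_ hT
    convert! d11.add d22 using 1
    ring
  · refine HasDerivAt.congr_of_eventuallyEq ?_ hD
    convert! (d11.mul d22).sub (d12.mul d21) using 1
    simp only [Function.comp_apply]
    ring

end GeodesicField

end RiemannianGeometry

theorem mainTheorem2 {M : Type*} [TopologicalSpace M] [T2Space M]
    [ChartedSpace (EuclideanSpace ℝ (Fin 3)) M] [IsManifold (𝓡 3) ∞ M]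
    [RiemannianBundle (fun x : M => TangentSpace (𝓡 3) x)]
    [IsContMDiffRiemannianBundle (𝓡 3) ∞ (EuclideanSpace ℝ (Fin 3))
      (fun x : M => TangentSpace (𝓡 3) x)]
    (c : ℝ) (hc : RiemannianGeometry.HasConstantSectionalCurvature (𝓡 3) M c)
    (X : Π x : M, TangentSpace (𝓡 3) x) (hX : RiemannianGeometry.IsGeodesicField X)
    (hcomplete : RiemannianGeometry.IsCompleteField X) (p : M) :
    (0 < c → ∀ μ : ℝ, ¬ (RiemannianGeometry.beta X hX p).HasEigenvalue μ) ∧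
    (c = 0 → ∀ μ : ℝ, (RiemannianGeometry.beta X hX p).HasEigenvalue μ → μ = 0) ∧
    (c < 0 → ∀ μ : ℝ, (RiemannianGeometry.beta X hX p).HasEigenvalue μ → |μ| ≤ √|c|) := by
  have hdim : Module.finrank ℝ (EuclideanSpace ℝ (Fin 3)) = 3 := finrank_euclideanSpace_fin
  -- Completeness enters here: the zero of `s` may occur at any real time, so `γ` must exist on all
  -- of `ℝ`.
  obtain ⟨γ, hγ0, hγ⟩ := hcomplete p
  obtain ⟨e, f, -, -, hon⟩ := RiemannianGeometry.exists_orthonormal_frame hdim hX.smooth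
    hX.norm_eq_one p
  have key : ∀ μ : ℝ, (RiemannianGeometry.beta X hX p).HasEigenvalue μ →
      ¬ 0 < c ∧ (c = 0 → μ = 0) ∧ (c < 0 → |μ| ≤ √|c|) := fun μ hμ =>
    RiemannianGeometry.riccati_eigenvalue
      (T := RiemannianGeometry.shapeTrace X ∘ γ) (D := RiemannianGeometry.shapeMinor X ∘ γ)
      (fun t => (hX.hasDerivAt_shape hdim hc hγ t).1)
      (fun t => (hX.hasDerivAt_shape hdim hc hγ t).2)
      (by
        simp only [Function.comp_apply, hγ0]
        exact hX.eigenvalue_beta hdim hon.self_of_nhds hμ)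
  exact ⟨fun h μ hμ => (key μ hμ).1 h, fun h μ hμ => (key μ hμ).2.1 h,
    fun h μ hμ => (key μ hμ).2.2 h⟩
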